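/- Let $p$ be a prime and let $X$ be a finite simple graph with $p$ vertices which is circulant, i.e. whose automorphism group $\mathrm{Aut}(X)$ contains a cycle of length $p$. Label the vertices by $\mathbb{Z}_p=\{0,1,\dots,p-1\}$ in such a way that all translations $i\mapsto i+k$ are automorphisms of $X$. Let $\mathcal{O}_0^1,\dots,\mathcal{O}_0^r$ be the orbits, other than $\{0\}$, of the stabilizer of $0$ in $\mathrm{Aut}(X)$ acting on the vertices, and for a vertex $i$ put $\mathcal{O}_i^s=\sigma(\mathcal{O}_0^s)$, where $\sigma\in\mathrm{Aut}(X)$ is any automorphism with $\sigma(0)=i$ (the set does not depend on the choice of $\sigma$). Let $S=\{k\in\mathbb{Z}_p : 0\sim k\}$ and let $E=\{a\in\mathbb{Z}_p^* : aS=S\}$. Let $A(X)$ be the universal unital $C^*$-algebra generated by the entries $u_{ij}$ of a $p\times p$ magic unitary matrix $u$ (all entries are projections, distinct entries of a same row or of a same column are orthogonal, and all row sums and column sums are equal to $1$) that commutes with the adjacency matrix of $X$. One says that $X$ has no quantum symmetry if $A(X)$ is commutative. Then the following two conditions are equivalent: 1. there exist $s_1,s_2\in\{1,\dots,r\}$ such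 that $|\mathcal{O}_0^{s_1}\cap\mathcal{O}_1^{s_2}|=1$; 2. there exist $x,x'\in\mathbb{Z}_p\setminus\{0\}$ such that $|xE\cap(x'E+1)|=1$. If they hold, then $X$ has no quantum symmetry. -/

import Mathlib

open scoped ENNReal Pointwise

noncomputable section

namespace QuantumSym

/-! ### The quantum automorphism algebra of a finite graph -/

/-- A magic unitary: a matrix of projections, with distinct elements of a same row or of a same
column orthogonal to each other, and with all row sums and column sums equal to `1`. -/
structure IsMagicUnitary {V A : Type*} [Fintype V] [Ring A] [StarRing A]
    (u : Matrix V V A) : Prop where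
  isStarProjection : ∀ i j, IsStarProjection (u i j)
  row_orthogonal : ∀ i j k, j ≠ k → u i j * u i k = 0
  col_orthogonal : ∀ i j k, i ≠ j → u i k * u j k = 0
  row_sum : ∀ i, ∑ j, u i j = 1
  col_sum : ∀ j, ∑ i, u i j = 1

open Classical in
/-- The defining relations of `A(X)`: `u` is a magic unitary and it commutes with the adjacency
matrix `d` of `X`. -/
structure SatisfiesRelations {V A : Type*} [Fintype V] [Ring A] [StarRing A]
    (X : SimpleGraph V) (u : Matrix V V A) : Prop where
  magic : IsMagicUnitary u
  comm : X.adjMatrix A * u = u * X.adjMatrix A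

/-- A representation of the relations of `A(X)`: a matrix satisfying them with entries in some
nonzero unital C⋆-algebra. -/
structure RelationRep {V : Type*} [Fintype V] (X : SimpleGraph V) where
  carrier : Type
  [cstar : CStarAlgebra carrier]
  [nontrivial : Nontrivial carrier]
  u : Matrix V V carrier
  rel : SatisfiesRelations X u

attribute [instance] RelationRep.cstar RelationRep.nontrivial

section Universal

variable {V : Type*} [Fintype V] (X : SimpleGraph V)

/-- The C⋆-algebra of bounded families indexed by all representations of the relations
(the `ℓ^∞` direct product of their C⋆-algebras). -/
abbrev RepProduct := lp (fun r : RelationRep X => r.carrier) ∞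

instance : CStarAlgebra (RepProduct X) where

/-- The generator `u i j`, evaluated in all representations at once. -/
def repGenerator (i j : V) : RepProduct X :=
  ⟨fun r => r.u i j, memℓp_infty ⟨1, by
    rintro _ ⟨r, rfl⟩
    exact (r.rel.magic.isStarProjection i j).norm_le⟩⟩

/-- The algebra `A(X)`: the universal unital C⋆-algebra generated by the entries of a magic unitary
matrix commuting with the adjacency matrix of `X`. It is the C⋆-algebra generated by the `u i j`
inside the product of all representations of these relations; see `QAut.existsUnique_hom` for
its universal property. (A C⋆-algebra generated by finitely many elements has at most the
cardinality of the continuum, so that `carrier : Type` is no restriction.) -/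
def QAut : StarSubalgebra ℂ (RepProduct X) :=
  (StarAlgebra.adjoin ℂ (Set.range fun ij : V × V => repGenerator X ij.1 ij.2)).topologicalClosure

instance : IsClosed (QAut X : Set (RepProduct X)) :=
  StarSubalgebra.isClosed_topologicalClosure _

/-- The generators of `A(X)`. -/
def QAut.u : Matrix V V (QAut X) := fun i j =>
  ⟨repGenerator X i j, StarSubalgebra.le_topologicalClosure _
    (StarAlgebra.subset_adjoin ℂ _ ⟨(i, j), rfl⟩)⟩

/-- Evaluation of `A(X)` in one representation. -/
def QAut.eval (r : RelationRep X) : QAut X →⋆ₐ[ℂ] r.carrier where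
  toFun a := (a : RepProduct X) r
  map_one' := rfl
  map_mul' _ _ := rfl
  map_zero' := rfl
  map_add' _ _ := rfl
  commutes' _ := rfl
  map_star' _ := rfl

theorem QAut.ext_eval {a b : QAut X} (h : ∀ r, QAut.eval X r a = QAut.eval X r b) : a = b :=
  Subtype.ext (lp.ext (funext h))

/-- The generators of `A(X)` satisfy the defining relations. -/
theorem QAut.satisfiesRelations : SatisfiesRelations X (QAut.u X) where
  magic :=
    { isStarProjection := fun i j =>
        ⟨QAut.ext_eval X fun r => (r.rel.magic.isStarProjection i j).isIdempotentElem,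
          QAut.ext_eval X fun r => (r.rel.magic.isStarProjection i j).isSelfAdjoint⟩
      row_orthogonal := fun i j k h =>
        QAut.ext_eval X fun r => r.rel.magic.row_orthogonal i j k h
      col_orthogonal := fun i j k h =>
        QAut.ext_eval X fun r => r.rel.magic.col_orthogonal i j k h
      row_sum := fun i => QAut.ext_eval X fun r => by
        rw [map_sum, map_one]; exact r.rel.magic.row_sum i
      col_sum := fun i => QAut.ext_eval X fun r => by
        rw [map_sum, map_one]; exact r.rel.magic.col_sum i }
  comm := by
    ext1 i j
    refine QAut.ext_eval X fun r => ?_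
    have h := congrFun (congrFun r.rel.comm i) j
    simp only [SimpleGraph.adjMatrix_mul_apply, SimpleGraph.mul_adjMatrix_apply] at h ⊢
    rw [map_sum, map_sum]
    exact h

/-- Universal property of `A(X)`: a matrix with entries in a unital C⋆-algebra that satisfies the
relations is the image of the generating matrix under exactly one unital ⋆-homomorphism. -/
theorem QAut.existsUnique_hom {B : Type} [CStarAlgebra B] (v : Matrix V V B)
    (hv : SatisfiesRelations X v) :
    ∃! φ : QAut X →⋆ₐ[ℂ] B, ∀ i j, φ (QAut.u X i j) = v i j := by
  cases subsingleton_or_nontrivial B with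
  | inl h =>
    refine ⟨{ toFun := fun _ => 0, map_one' := Subsingleton.elim _ _
              map_mul' := fun _ _ => Subsingleton.elim _ _, map_zero' := rfl
              map_add' := fun _ _ => Subsingleton.elim _ _
              commutes' := fun _ => Subsingleton.elim _ _
              map_star' := fun _ => Subsingleton.elim _ _ },
      fun _ _ => Subsingleton.elim _ _, fun _ _ => StarAlgHom.ext fun _ => Subsingleton.elim _ _⟩
  | inr h =>
    refine ⟨QAut.eval X ⟨B, v, hv⟩, fun _ _ => rfl, fun ψ hψ => ?_⟩
    have h₁ : Continuous ψ :=
      AddMonoidHomClass.continuous_of_bound ψ 1 fun a => by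
        simpa only [one_mul] using NonUnitalStarAlgHom.norm_apply_le ψ a
    have h₂ : Continuous (QAut.eval X ⟨B, v, hv⟩) :=
      AddMonoidHomClass.continuous_of_bound _ 1 fun a => by
        simpa only [one_mul] using NonUnitalStarAlgHom.norm_apply_le (QAut.eval X ⟨B, v, hv⟩) a
    refine StarAlgHom.ext_topologicalClosure h₁ h₂ ?_
    refine StarAlgHom.ext_adjoin fun a ha => ?_
    obtain ⟨⟨i, j⟩, hij⟩ := ha
    obtain ⟨a, ha'⟩ := a
    subst hij
    exact hψ i j

end Universal

/-- `X` has no quantum symmetry: the algebra `A(X)` is commutative. -/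
def NoQuantumSymmetry {V : Type*} [Fintype V] (X : SimpleGraph V) : Prop :=
  ∀ a b : QAut X, a * b = b * a

/-! ### Orbitals -/

section Orbitals

variable {V : Type*} (X : SimpleGraph V)

/-- `O` is an orbit, other than `{v}`, of the stabilizer of `v` in `Aut(X)` on the vertices. -/
def IsNontrivialOrbit (v : V) (O : Set V) : Prop :=
  ∃ w : V, w ≠ v ∧ O = {z | ∃ σ : X ≃g X, σ v = v ∧ σ w = z}

/-- For an orbit `O` of the stabilizer of the base vertex `v`, the corresponding set at the vertex
`i`, which is `σ '' O` for any automorphism `σ` with `σ v = i`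
(see `orbitAt_eq_image`: they all give the same set). -/
def orbitAt (v : V) (O : Set V) (i : V) : Set V :=
  {z | ∃ σ : X ≃g X, σ v = i ∧ z ∈ σ '' O}

theorem orbitAt_eq_image {v : V} {O : Set V} (hO : IsNontrivialOrbit X v O) (σ : X ≃g X) :
    orbitAt X v O (σ v) = σ '' O := by
  obtain ⟨w, -, rfl⟩ := hO
  ext z
  constructor
  · rintro ⟨τ, hτ, _, ⟨ρ, hρ, rfl⟩, rfl⟩
    exact ⟨σ.symm (τ (ρ w)), ⟨(ρ.trans τ).trans σ.symm, by simp [hρ, hτ], rfl⟩, by simp⟩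
  · intro hz
    exact ⟨σ, rfl, hz⟩

end Orbitals

/-! ### Circulant graphs -/

section Circulant

variable {V : Type*} {n : ℕ} (X : SimpleGraph V)

/-- `X` is circulant: an automorphism of `X` permutes all the vertices in a single cycle. -/
def IsCirculant : Prop :=
  ∃ σ : X ≃g X, Equiv.Perm.IsCycleOn (σ.toEquiv : Equiv.Perm V) Set.univ

/-- A circulant labelling: the vertices are numbered by `ℤ/n` in such a way that the translations
are automorphisms (see `isCirculant_iff_exists_labelling`). -/
def IsCirculantLabelling (e : ZMod n ≃ V) : Prop :=
  ∀ i j k : ZMod n, X.Adj (e i) (e j) → X.Adj (e (i + k)) (e (j + k))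

theorem isCirculant_iff_exists_labelling [Fintype V] [NeZero n] (hn : Fintype.card V = n) :
    IsCirculant X ↔ ∃ e : ZMod n ≃ V, IsCirculantLabelling X e := by
  classical
  have key : ∀ τ : X ≃g X, ∀ m : ℕ, ∀ a b : V, X.Adj a b →
      X.Adj ((τ.toEquiv ^ m : Equiv.Perm V) a) ((τ.toEquiv ^ m : Equiv.Perm V) b) := by
    intro τ m
    induction m with
    | zero => intro a b h; exact h
    | succ m ih =>
      intro a b h
      rw [pow_succ, Equiv.Perm.mul_apply, Equiv.Perm.mul_apply]
      exact ih _ _ (τ.map_rel_iff.mpr h)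
  constructor
  · rintro ⟨σ, hσ⟩
    have hpos : 0 < Fintype.card V := hn ▸ Nat.pos_of_ne_zero (NeZero.ne n)
    obtain ⟨v⟩ : Nonempty V := Fintype.card_pos_iff.mp hpos
    set π : Equiv.Perm V := σ.toEquiv with hπ
    have hσ' : π.IsCycleOn ((Finset.univ : Finset V) : Set V) := by simpa using hσ
    have hcard : (Finset.univ : Finset V).card = n := by rw [Finset.card_univ, hn]
    let f : ZMod n → V := fun k => (π ^ k.val) v
    have hf : Function.Injective f := fun k l h => by
      have h' := (hσ'.pow_apply_eq_pow_apply (Finset.mem_univ v)).mp h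
      rw [hcard] at h'
      have := (ZMod.natCast_eq_natCast_iff _ _ _).mpr h'
      simpa using this
    have hf' : Function.Bijective f :=
      (Fintype.bijective_iff_injective_and_card f).mpr ⟨hf, by rw [ZMod.card, hn]⟩
    have hadd : ∀ i k : ZMod n, f (i + k) = (π ^ k.val) (f i) := fun i k => by
      change (π ^ (i + k).val) v = (π ^ k.val) ((π ^ i.val) v)
      rw [← Equiv.Perm.mul_apply, ← pow_add]
      refine (hσ'.pow_apply_eq_pow_apply (Finset.mem_univ v)).mpr ?_
      rw [hcard, ← ZMod.natCast_eq_natCast_iff]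
      simp [add_comm]
    refine ⟨Equiv.ofBijective f hf', fun i j k h => ?_⟩
    change X.Adj (f (i + k)) (f (j + k))
    rw [hadd, hadd]
    exact key σ _ _ _ h
  · rintro ⟨e, he⟩
    let π : Equiv.Perm V := (e.symm.trans (Equiv.addRight 1)).trans e
    have hpow : ∀ (m : ℕ) (i : ZMod n), (π ^ m) (e i) = e (i + m) := by
      intro m
      induction m with
      | zero => simp
      | succ m ih =>
        intro i
        rw [pow_succ', Equiv.Perm.mul_apply, ih]
        simp [π, add_assoc]
    refine ⟨⟨π, fun {a b} => ⟨fun h => ?_, fun h => ?_⟩⟩, ?_, fun a _ b _ => ?_⟩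
    · have := he _ _ (-1) h
      simpa using this
    · have := he (e.symm a) (e.symm b) 1 (by simpa using h)
      simpa [π] using this
    · exact Set.bijOn_univ.mpr π.bijective
    · refine ⟨((e.symm b - e.symm a).val : ℕ), ?_⟩
      have := hpow (e.symm b - e.symm a).val (e.symm a)
      rw [zpow_natCast]
      simpa using this

/-- The connection set `S`: `i ∼ j ↔ j - i ∈ S`. -/
def connectionSet (e : ZMod n ≃ V) : Set (ZMod n) :=
  {k | X.Adj (e 0) (e k)}

/-- The group `E` of the units `a` of `ℤ/n` with `aS = S`. -/
def multiplierGroup (e : ZMod n ≃ V) : Subgroup (ZMod n)ˣ :=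
  MulAction.stabilizer (ZMod n)ˣ (connectionSet X e)

/-- The set `xE + c` of all `x a + c` with `a ∈ E`. -/
def affineCoset (e : ZMod n ≃ V) (x c : ZMod n) : Set (ZMod n) :=
  {z | ∃ a ∈ multiplierGroup X e, z = x * (a : ZMod n) + c}

/-- Some nontrivial orbitals `s₁, s₂` satisfy `|O_0^{s₁} ∩ O_1^{s₂}| = 1`. -/
def HasSingletonIntersection (e : ZMod n ≃ V) : Prop :=
  ∃ O₁ O₂ : Set V, IsNontrivialOrbit X (e 0) O₁ ∧ IsNontrivialOrbit X (e 0) O₂ ∧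
    (O₁ ∩ orbitAt X (e 0) O₂ (e 1)).ncard = 1

end Circulant

end QuantumSym

end

noncomputable section

namespace QuantumSym

/-! ### Multipliers of convolution-closed partitions of `ℤ/p` -/

section Multipliers

open Finset

/-! The proof rests on Schur's theorem on multipliers. If the classes of a partition of `ℤ/p` span a
Schur ring, every unit permutes the classes (`rel_mul`), so related elements differ by a unit fixing
all classes, hence stabilizing any union `S` of classes (`exists_mem_stabilizer`).

For the orbits of the stabilizer of `0` this says that they are the cosets `xE`, whence the
equivalence. For the differences that a magic unitary does not distinguish it says that `u i j * u k
l ≠ 0` forces `l - j ∈ (k - i)E`.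

A singleton intersection provides `w ≠ 0, 1` determined by its `E`-cosets relative to `0` and `1`.
Put `P = u (i + w(k - i)) (j + w(l - j))`. Rigidity gives `u i j * u k l = u i j * P`, and by the
symmetry `w ↦ 1 - w` also `u k l * u i j = u k l * P`. So `u i j * u k l * u i j = u i j * u k l`;
the left side is self-adjoint, and the two entries commute. -/

/-- Functions that are constant on the classes of `r`. -/
def ClassInvariant {α β : Type*} (r : Setoid α) (f : α → β) : Prop :=
  ∀ a b, r a b → f a = f b

/-- The integer valued functions that are constant on the classes of `r` are closed under
convolution, and `{0}` is one of the classes: the classes of `r` span a Schur ring. -/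
structure IsSchurPartition {p : ℕ} [NeZero p] (r : Setoid (ZMod p)) : Prop where
  eq_zero_iff : ∀ a b, r a b → (a = 0 ↔ b = 0)
  convolution : ∀ f g : ZMod p → ℤ, ClassInvariant r f → ClassInvariant r g →
    ClassInvariant r fun y => ∑ x, f x * g (y - x)

variable {p : ℕ} [Fact p.Prime] {r : Setoid (ZMod p)}

/-- Multiplication in the group ring is convolution of coefficients. With exponent `n + 1` the
induction starts at `F` itself. -/
theorem IsSchurPartition.coeff_pow (hr : IsSchurPartition r) (F : AddMonoidAlgebra ℤ (ZMod p))
    (hF : ClassInvariant r F.coeff) (n : ℕ) : ClassInvariant r (F ^ (n + 1)).coeff := by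
  induction n with
  | zero => simpa using hF
  | succ n ih =>
    have h := hr.convolution _ _ hF ih
    intro a b hab
    have key : ∀ y, (F ^ (n + 1 + 1)).coeff y = ∑ x, F.coeff x * (F ^ (n + 1)).coeff (y - x) := by
      intro y
      rw [pow_succ' F (n + 1), AddMonoidAlgebra.coeff_mul_apply_left, Finsupp.sum_fintype]
      · simp [neg_add_eq_sub]
      · simp
    rw [key, key]
    exact h a b hab

/-- A prime `q ≠ p` maps invariant sets to invariant sets, as `(∑ t) ^ q = ∑ t ^ q` modulo `q`. -/
theorem IsSchurPartition.invariant_prime_mul (hr : IsSchurPartition r) {q : ℕ} (hq : q.Prime)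
    (hqp : (q : ZMod p) ≠ 0) (T : Set (ZMod p)) (hT : ClassInvariant r (· ∈ T)) :
    ClassInvariant r (fun y => ∃ t ∈ T, y = q * t) := by
  classical
  have := Fact.mk hq
  let F : AddMonoidAlgebra ℤ (ZMod p) := ∑ t ∈ univ.filter (· ∈ T), AddMonoidAlgebra.single t 1
  have hF : ClassInvariant r F.coeff := by
    intro a b hab
    have h : (a ∈ T) = (b ∈ T) := hT a b hab
    simp [F, AddMonoidAlgebra.coeff_sum, Finsupp.finsetSum_apply, Finsupp.single_apply, h]
  let φ := AddMonoidAlgebra.mapRingHom (ZMod p) (Int.castRingHom (ZMod q))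
  have hφ : φ (F ^ q) = ∑ t ∈ univ.filter (· ∈ T), AddMonoidAlgebra.single ((q : ZMod p) * t) 1 := by
    have : CharP (AddMonoidAlgebra (ZMod q) (ZMod p)) q :=
      charP_of_injective_algebraMap (algebraMap (ZMod q) _).injective q
    simp [φ, F, map_pow, map_sum, sum_pow_char, AddMonoidAlgebra.single_pow]
  -- Multiplication by `q` is injective on `ZMod p`, so the terms do not collide: modulo `q`, the
  -- coefficients of `F ^ q` form the indicator of `qT`.
  have key : ∀ y, (((F ^ q).coeff y : ℤ) : ZMod q) = if ∃ t ∈ T, y = q * t then 1 else 0 := by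
    intro y
    have h1 : (φ (F ^ q)).coeff y = (((F ^ q).coeff y : ℤ) : ZMod q) := by
      simp only [φ, AddMonoidAlgebra.coeff_mapRingHom]
      rfl
    rw [← h1, hφ, AddMonoidAlgebra.coeff_sum, Finsupp.finsetSum_apply]
    simp only [AddMonoidAlgebra.coeff_single, Finsupp.single_apply]
    split_ifs with h
    · obtain ⟨t, ht, rfl⟩ := h
      rw [sum_eq_single_of_mem t (by simpa using ht)]
      · simp
      · intro b _ hb
        rw [if_neg]
        exact fun h => hb (mul_left_cancel₀ hqp h)
    · refine sum_eq_zero fun t ht => if_neg fun h' => h ⟨t, by simpa using ht, h'.symm⟩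
  obtain ⟨m, hm⟩ : ∃ m, q = m + 1 := ⟨q - 1, by have := hq.pos; omega⟩
  have hinv : ClassInvariant r (F ^ q).coeff := hm ▸ hr.coeff_pow F hF m
  intro a b hab
  have h := (key a).symm.trans ((congrArg _ (hinv a b hab)).trans (key b))
  change (∃ t ∈ T, a = q * t) = (∃ t ∈ T, b = q * t)
  by_cases ha : ∃ t ∈ T, a = q * t <;> by_cases hb : ∃ t ∈ T, b = q * t
  · rw [eq_true ha, eq_true hb]
  · rw [if_pos ha, if_neg hb] at h
    exact absurd h one_ne_zero
  · rw [if_neg ha, if_pos hb] at h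
    exact absurd h zero_ne_one
  · rw [eq_false ha, eq_false hb]

theorem IsSchurPartition.invariant_natCast_mul (hr : IsSchurPartition r) (n : ℕ) :
    (n : ZMod p) ≠ 0 → ∀ T : Set (ZMod p), ClassInvariant r (· ∈ T) →
      ClassInvariant r (fun y => ∃ t ∈ T, y = n * t) := by
  induction n using induction_on_primes with
  | zero => simp
  | one => simp
  | prime_mul q n hq ih =>
    intro hn T hT a b hab
    rw [Nat.cast_mul] at hn
    have h := hr.invariant_prime_mul hq (left_ne_zero_of_mul hn) {y | ∃ t ∈ T, y = n * t}
      (ih (right_ne_zero_of_mul hn) T hT) a b hab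
    simpa [mul_assoc] using h

/-- Let `T` be the class of `a * z`. Then `a⁻¹T` is invariant and contains `z`, hence `w`. -/
theorem IsSchurPartition.rel_mul (hr : IsSchurPartition r) {a : ZMod p} (ha : a ≠ 0)
    {z w : ZMod p} (h : r z w) : r (a * z) (a * w) := by
  have hcast : (((a⁻¹ : ZMod p).val : ℕ) : ZMod p) = a⁻¹ := ZMod.natCast_zmod_val _
  have hinv := hr.invariant_natCast_mul (a⁻¹ : ZMod p).val (by rw [hcast]; exact inv_ne_zero ha)
    {y | r (a * z) y}
    (fun b c hbc => propext ⟨fun h' => r.trans h' hbc, fun h' => r.trans h' (r.symm hbc)⟩) z w h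
  rw [hcast] at hinv
  obtain ⟨t, ht, rfl⟩ := hinv.mp ⟨a * z, r.refl _, by rw [inv_mul_cancel_left₀ ha]⟩
  rwa [mul_inv_cancel_left₀ ha]

/-- Related elements differ by a unit which preserves every class. -/
theorem IsSchurPartition.exists_multiplier (hr : IsSchurPartition r) {z w : ZMod p} (h : r z w) :
    ∃ c : (ZMod p)ˣ, w = c * z ∧ ∀ x, r x (c * x) := by
  by_cases hz : z = 0
  · have hw := (hr.eq_zero_iff z w h).mp hz
    exact ⟨1, by simp [hz, hw], fun x => by simp⟩
  · have hw : w ≠ 0 := fun hw => hz ((hr.eq_zero_iff z w h).mpr hw)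
    -- Multiplying `r z w` by `x / z` gives `r x ((w / z) * x)`.
    refine ⟨Units.mk0 (w / z) (div_ne_zero hw hz), by simp [hz], fun x => ?_⟩
    by_cases hx : x = 0
    · simp [hx]
    · have := hr.rel_mul (div_ne_zero hx hz) h
      rw [div_mul_cancel₀ x hz] at this
      rwa [Units.val_mk0, div_mul_comm]

theorem IsSchurPartition.exists_mem_stabilizer (hr : IsSchurPartition r) {S : Set (ZMod p)}
    (hS : ClassInvariant r (· ∈ S)) {z w : ZMod p} (h : r z w) :
    ∃ c ∈ MulAction.stabilizer (ZMod p)ˣ S, w = (c : ZMod p) * z := by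
  obtain ⟨c, hc, hcr⟩ := hr.exists_multiplier h
  refine ⟨c, ?_, hc⟩
  rw [MulAction.mem_stabilizer_iff]
  ext x
  rw [Set.mem_smul_set_iff_inv_smul_mem]
  have := hS _ _ (hcr (c⁻¹ • x))
  rw [show (c : ZMod p) * c⁻¹ • x = x from smul_inv_smul c x] at this
  exact this.to_iff

end Multipliers

/-! ### Quantum orbitals -/

section QuantumOrbitals

open Finset

/-- Multiplying the `(i, l)` entries of both sides by `u i j` on the left and `u k l` on the right
isolates `D i k` and `D j l` as coefficients of `u i j * u k l`. Conversely, the row and column sums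
recover the entries from these products. -/
theorem IsMagicUnitary.intCast_comm_iff {V A : Type*} [Fintype V] [Ring A] [StarRing A]
    [Module ℂ A] {u : Matrix V V A} (hu : IsMagicUnitary u) (D : Matrix V V ℤ) :
    D.map (Int.cast : ℤ → A) * u = u * D.map (Int.cast : ℤ → A) ↔
      ∀ i j k l, u i j * u k l ≠ 0 → D i k = D j l := by
  constructor
  · intro h i j k l hne
    have hil := congrArg (fun a => u i j * a * u k l) (congrFun (congrFun h i) l)
    simp only [Matrix.mul_apply, Matrix.map_apply, mul_sum, sum_mul] at hil
    rw [sum_eq_single k, sum_eq_single j] at hil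
    · have h1 : u i j * ((D i k : A) * u k l) * u k l = (D i k) • (u i j * u k l) := by
        rw [mul_assoc, mul_assoc, (hu.isStarProjection k l).isIdempotentElem.eq,
          ← zsmul_eq_mul, mul_smul_comm]
      have h2 : u i j * (u i j * (D j l : A)) * u k l = (D j l) • (u i j * u k l) := by
        rw [← mul_assoc, (hu.isStarProjection i j).isIdempotentElem.eq, mul_assoc,
          ← zsmul_eq_mul, mul_smul_comm]
      -- The complex structure makes `A` torsion-free, so the integer coefficient must vanish.
      rw [h1, h2, ← sub_eq_zero, ← sub_smul, ← Int.cast_smul_eq_zsmul ℂ] at hil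
      have := (smul_eq_zero.mp hil).resolve_right hne
      exact sub_eq_zero.mp (by exact_mod_cast this)
    · intro m _ hm
      rw [← mul_assoc, hu.row_orthogonal i j m hm.symm, zero_mul, zero_mul]
    · simp
    · intro m _ hm
      rw [mul_assoc, mul_assoc, hu.col_orthogonal m k l hm, mul_zero, mul_zero]
    · simp
  · intro h
    ext i l
    have key : ∀ j k, u i j * ((D i k : A) * u k l) = u i j * (D j l : A) * u k l := by
      intro j k
      by_cases hne : u i j * u k l = 0
      · rw [← zsmul_eq_mul, mul_smul_comm, hne, mul_assoc, ← zsmul_eq_mul, mul_smul_comm, hne,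
          smul_zero, smul_zero]
      · rw [h i j k l hne, mul_assoc]
    simp only [Matrix.mul_apply, Matrix.map_apply]
    calc ∑ k, (D i k : A) * u k l = (∑ j, u i j) * ∑ k, (D i k : A) * u k l := by
          rw [hu.row_sum, one_mul]
      _ = ∑ j, ∑ k, u i j * (D j l : A) * u k l := by
          rw [sum_mul_sum]
          exact sum_congr rfl fun j _ => sum_congr rfl fun k _ => key j k
      _ = ∑ j, u i j * (D j l : A) := by
          refine sum_congr rfl fun j _ => ?_
          rw [← mul_sum, hu.col_sum, mul_one]

variable {p : ℕ} [Fact p.Prime] {A : Type*} [Ring A] [StarRing A]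

/-- The differences that a magic unitary on `ℤ/p` does not distinguish. -/
def quantumOrbitalSetoid (u : Matrix (ZMod p) (ZMod p) A) : Setoid (ZMod p) :=
  Relation.EqvGen.setoid fun d d' => ∃ i j k l, u i j * u k l ≠ 0 ∧ d = k - i ∧ d' = l - j

/-- The matrix `(f (k - i))_{ik}`. -/
def differenceMatrix (f : ZMod p → ℤ) : Matrix (ZMod p) (ZMod p) ℤ :=
  Matrix.of fun i k => f (k - i)

theorem differenceMatrix_mul (f g : ZMod p → ℤ) :
    differenceMatrix f * differenceMatrix g =
      differenceMatrix fun y => ∑ x, f x * g (y - x) := by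
  ext i k
  simp only [differenceMatrix, Matrix.mul_apply, Matrix.of_apply]
  exact Fintype.sum_equiv (Equiv.subRight i) _ _ fun j => by
    simp [sub_sub_sub_cancel_right]

variable [Module ℂ A] {u : Matrix (ZMod p) (ZMod p) A}

theorem IsMagicUnitary.classInvariant_iff (hu : IsMagicUnitary u) (f : ZMod p → ℤ) :
    ClassInvariant (quantumOrbitalSetoid u) f ↔
      (differenceMatrix f).map (Int.cast : ℤ → A) * u =
        u * (differenceMatrix f).map (Int.cast : ℤ → A) := by
  rw [hu.intCast_comm_iff]
  constructor
  · intro h i j k l hne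
    exact h _ _ (Relation.EqvGen.rel _ _ ⟨i, j, k, l, hne, rfl, rfl⟩)
  · intro h a b hab
    induction hab with
    | rel a b hab =>
      obtain ⟨i, j, k, l, hne, rfl, rfl⟩ := hab
      exact h i j k l hne
    | refl => rfl
    | symm _ _ _ ih => exact ih.symm
    | trans _ _ _ _ _ ih₁ ih₂ => exact ih₁.trans ih₂

/-- Matrices commuting with `u` are closed under products and contain `1`; for difference matrices
these are convolution and the indicator of `0`. -/
theorem IsMagicUnitary.isSchurPartition (hu : IsMagicUnitary u) :
    IsSchurPartition (quantumOrbitalSetoid u) where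
  eq_zero_iff a b hab := by
    classical
    have h := (hu.classInvariant_iff (Pi.single 0 1)).mpr (by
      have : differenceMatrix (p := p) (Pi.single 0 1) = 1 := by
        ext i k
        simp [differenceMatrix, Pi.single_apply, Matrix.one_apply, sub_eq_zero, eq_comm]
      rw [this, Matrix.map_one _ Int.cast_zero Int.cast_one, one_mul, mul_one]) a b hab
    by_cases ha : a = 0 <;> by_cases hb : b = 0 <;> simp_all
  convolution f g hf hg := by
    rw [hu.classInvariant_iff] at hf hg ⊢
    rw [← differenceMatrix_mul]
    have : (differenceMatrix f * differenceMatrix g).map (Int.cast : ℤ → A) =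
        (differenceMatrix f).map (Int.cast : ℤ → A) *
          (differenceMatrix g).map (Int.cast : ℤ → A) :=
      Matrix.map_mul (f := Int.castRingHom A)
    rw [this, mul_assoc, hg, ← mul_assoc, hf, mul_assoc]

open Classical in
/-- The entries of a magic unitary which commutes with the adjacency matrix of the circulant graph
of connection set `S` respect the cosets of the multiplier group of `S`. -/
theorem IsMagicUnitary.exists_mem_stabilizer (hu : IsMagicUnitary u) {S : Set (ZMod p)}
    (hS : (Matrix.of fun i k => if k - i ∈ S then (1 : A) else 0) * u =
      u * Matrix.of fun i k => if k - i ∈ S then (1 : A) else 0)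
    {i j k l : ZMod p} (hne : u i j * u k l ≠ 0) :
    ∃ c ∈ MulAction.stabilizer (ZMod p)ˣ S, l - j = (c : ZMod p) * (k - i) := by
  refine hu.isSchurPartition.exists_mem_stabilizer (S := S) ?_
    (Relation.EqvGen.rel _ _ ⟨i, j, k, l, hne, rfl, rfl⟩)
  have h := (hu.classInvariant_iff fun x => if x ∈ S then 1 else 0).mpr (by
    convert hS using 2 <;> (ext i k; simp [differenceMatrix]))
  intro a b hab
  have := h a b hab
  by_cases ha : a ∈ S <;> by_cases hb : b ∈ S <;> simp_all

end QuantumOrbitals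

/-! ### Commutation of the entries of a magic unitary -/

section Commutation

open Finset

variable {p : ℕ} [Fact p.Prime] {A : Type*} [Ring A] [StarRing A]
  {u : Matrix (ZMod p) (ZMod p) A} {E : Subgroup (ZMod p)ˣ}

/-- `u` preserves the cosets of `E` among the differences of indices. -/
def RespectsCosets (u : Matrix (ZMod p) (ZMod p) A) (E : Subgroup (ZMod p)ˣ) : Prop :=
  ∀ i j k l, u i j * u k l ≠ 0 → ∃ c ∈ E, l - j = (c : ZMod p) * (k - i)

/-- `wE ∩ ((w - 1)E + 1) = {w}`. -/
def IsIsolating (E : Subgroup (ZMod p)ˣ) (w : ZMod p) : Prop :=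
  ∀ z, (∃ a ∈ E, z = w * (a : ZMod p)) → (∃ b ∈ E, z - 1 = (w - 1) * (b : ZMod p)) → z = w

/-- The reflection `z ↦ 1 - z` exchanges the two coset conditions. -/
theorem IsIsolating.one_sub {w : ZMod p} (hw : IsIsolating E w) :
    IsIsolating E (1 - w) := by
  rintro z ⟨a, ha, hza⟩ ⟨b, hb, hzb⟩
  have h := hw (1 - z) ⟨b, hb, by linear_combination -hzb⟩ ⟨a, ha, by linear_combination -hza⟩
  linear_combination -h

theorem IsIsolating.eq_mul {w : ZMod p} (hw : IsIsolating E w) {z d : ZMod p}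
    (h₁ : ∃ a ∈ E, z = w * d * (a : ZMod p)) (h₂ : ∃ b ∈ E, z - d = (w - 1) * d * (b : ZMod p)) :
    z = w * d := by
  obtain ⟨a, ha, hza⟩ := h₁
  obtain ⟨b, hb, hzb⟩ := h₂
  by_cases hd : d = 0
  · simp [hza, hd]
  · have h := hw (z / d) ⟨a, ha, by field_simp; linear_combination hza⟩
      ⟨b, hb, by field_simp; linear_combination hzb⟩
    rw [← h, div_mul_cancel₀ _ hd]

/-- If `(0, 1, w)` is rigid up to `E`, then a middle term may be inserted between two entries. -/
theorem IsMagicUnitary.mul_eq_mul_mul (hu : IsMagicUnitary u) (hE : RespectsCosets u E)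
    {w : ZMod p} (hw : IsIsolating E w) (i j k : ZMod p) {d : ZMod p} (d' : ZMod p)
    (h₁ : ∃ a ∈ E, d' = (a : ZMod p) * d)
    (h₂ : ∃ b ∈ E, (1 - w) * d' = (b : ZMod p) * (k - (i + w * d))) :
    u i j * u k (j + d') = u i j * u (i + w * d) (j + w * d') * u k (j + d') := by
  obtain ⟨a, ha, hda⟩ := h₁
  obtain ⟨b, hb, hdb⟩ := h₂
  calc u i j * u k (j + d') = ∑ q, u i j * u (i + w * d) q * u k (j + d') := by
        rw [← sum_mul, ← mul_sum, hu.row_sum, mul_one]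
    -- A nonzero term fixes the cosets of `q - j` and `q - (j + d')`; isolation at scale `d'` leaves
    -- only `q = j + w * d'`.
    _ = _ := by
        refine sum_eq_single (j + w * d') (fun q _ hq => ?_) (by simp)
        by_contra hne
        obtain ⟨c, hc, hqc⟩ := hE i j (i + w * d) q (left_ne_zero_of_mul hne)
        obtain ⟨c', hc', hqc'⟩ := hE (i + w * d) q k (j + d')
          (right_ne_zero_of_mul (mul_assoc (u i j) _ _ ▸ hne))
        refine hq (sub_eq_iff_eq_add'.mp (hw.eq_mul (d := d')
          ⟨c * a⁻¹, E.mul_mem hc (E.inv_mem ha), ?_⟩ ⟨c' * b⁻¹, E.mul_mem hc' (E.inv_mem hb), ?_⟩))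
        · rw [hqc, hda, Units.val_mul]
          have := a.inv_mul
          linear_combination -(c : ZMod p) * w * d * this
        · rw [Units.val_mul]
          have := b.inv_mul
          have h3 : ((b⁻¹ : (ZMod p)ˣ) : ZMod p) * ((1 - w) * d') = k - (i + w * d) := by
            rw [hdb, ← mul_assoc, this, one_mul]
          rw [← h3] at hqc'
          linear_combination -hqc'

/-- The product of two entries does not change if the second one is moved by the factor `w`. -/
theorem IsMagicUnitary.mul_eq_mul_dilate (hu : IsMagicUnitary u) (hE : RespectsCosets u E)
    {w : ZMod p} (hw : IsIsolating E w) (hw₀ : w ≠ 0) (i j d d' : ZMod p) :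
    u i j * u (i + d) (j + d') = u i j * u (i + w * d) (j + w * d') := by
  by_cases hd : ∃ a ∈ E, d' = (a : ZMod p) * d
  · obtain ⟨a, ha, hda⟩ := hd
    rw [hu.mul_eq_mul_mul hE hw i j (i + d) d' ⟨a, ha, hda⟩
      ⟨a, ha, by rw [hda]; ring⟩]
    -- Inserting the sum of column `j + d'` reduces the claim to showing that only row `i + d`
    -- contributes.
    conv_rhs => rw [← mul_one (u i j * _), ← hu.col_sum (j + d'), mul_sum]
    symm
    refine sum_eq_single (i + d) (fun k _ hk => ?_) (by simp)
    by_contra hne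
    obtain ⟨b, hb, hkb⟩ := hE (i + w * d) (j + w * d') k (j + d')
      (right_ne_zero_of_mul (mul_assoc (u i j) _ _ ▸ hne))
    have hkb' : (1 - w) * d' = (b : ZMod p) * (k - (i + w * d)) := by
      rw [← hkb]; ring
    -- The insertion lemma, read backwards, removes the middle factor, so `d'` lies in the coset of
    -- `k - i`. Isolation at scale `k - i` then gives `w * d = w * (k - i)`.
    rw [← hu.mul_eq_mul_mul hE hw i j k d' ⟨a, ha, hda⟩ ⟨b, hb, hkb'⟩] at hne
    obtain ⟨c, hc, hkc⟩ := hE _ _ _ _ hne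
    have hkc' : d' = (c : ZMod p) * (k - i) := by rw [← hkc]; ring
    have h := hw.eq_mul (z := w * d) (d := k - i) ⟨a⁻¹ * c, E.mul_mem (E.inv_mem ha) hc, ?_⟩
      ⟨b⁻¹ * c, E.mul_mem (E.inv_mem hb) hc, ?_⟩
    · have := mul_left_cancel₀ hw₀ h
      exact hk (by rw [this]; ring)
    · rw [Units.val_mul]
      have h3 := a.inv_mul
      linear_combination -(w * d) * h3 + w * (a⁻¹ : (ZMod p)ˣ) * (hkc' - hda)
    · rw [Units.val_mul]
      have h3 := b.inv_mul
      linear_combination (k - (i + w * d)) * h3 + (b⁻¹ : (ZMod p)ˣ) * (hkb' + (w - 1) * hkc')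
  -- Outside the coset of `d` both products vanish, since `w` cancels.
  · have h1 : u i j * u (i + d) (j + d') = 0 := by
      by_contra hne
      obtain ⟨c, hc, h⟩ := hE _ _ _ _ hne
      exact hd ⟨c, hc, by linear_combination h⟩
    have h2 : u i j * u (i + w * d) (j + w * d') = 0 := by
      by_contra hne
      obtain ⟨c, hc, h⟩ := hE _ _ _ _ hne
      refine hd ⟨c, hc, mul_left_cancel₀ hw₀ ?_⟩
      linear_combination h
    rw [h1, h2]

theorem IsMagicUnitary.commute (hu : IsMagicUnitary u) (hE : RespectsCosets u E)
    {w : ZMod p} (hw : IsIsolating E w) (hw₀ : w ≠ 0) (hw₁ : w ≠ 1) (i j k l : ZMod p) :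
    Commute (u i j) (u k l) := by
  have h1 : u i j * u k l = u i j * u (i + w * (k - i)) (j + w * (l - j)) := by
    have := hu.mul_eq_mul_dilate hE hw hw₀ i j (k - i) (l - j)
    rwa [add_sub_cancel, add_sub_cancel] at this
  have h2 : u k l * u i j = u k l * u (i + w * (k - i)) (j + w * (l - j)) := by
    have := hu.mul_eq_mul_dilate hE hw.one_sub (sub_ne_zero.mpr hw₁.symm) k l
      (i - k) (j - l)
    rwa [add_sub_cancel, add_sub_cancel, show k + (1 - w) * (i - k) = i + w * (k - i) by ring,
      show l + (1 - w) * (j - l) = j + w * (l - j) by ring] at this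
  have h3 : u i j * u k l * u i j = u i j * u k l := by
    rw [mul_assoc, h2, ← mul_assoc, h1, mul_assoc,
      (hu.isStarProjection _ _).isIdempotentElem.eq]
  have h4 := congrArg star h3
  simp only [star_mul, (hu.isStarProjection i j).isSelfAdjoint.star_eq,
    (hu.isStarProjection k l).isSelfAdjoint.star_eq] at h4
  rw [← mul_assoc, h3] at h4
  exact h4

end Commutation

/-! ### Orbits of the stabilizer of a vertex -/

section ClassicalOrbits

open Finset

variable {V : Type*} {X : SimpleGraph V} {p : ℕ} {e : ZMod p ≃ V}

theorem IsCirculantLabelling.adj_iff (he : IsCirculantLabelling X e) (i j : ZMod p) :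
    X.Adj (e i) (e j) ↔ j - i ∈ connectionSet X e := by
  constructor
  · intro h
    simpa [connectionSet, sub_eq_add_neg] using he i j (-i) h
  · intro h
    simpa using he 0 (j - i) i h

/-- The automorphism of `X` given by an affine bijection of `ℤ/p`. -/
def IsCirculantLabelling.affineIso (he : IsCirculantLabelling X e) {a : (ZMod p)ˣ}
    (ha : a ∈ multiplierGroup X e) (c : ZMod p) : X ≃g X where
  toEquiv := (e.symm.trans ((Units.mulLeft a).trans (Equiv.addRight c))).trans e
  map_rel_iff' {v w} := by
    obtain ⟨i, rfl⟩ := e.surjective v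
    obtain ⟨j, rfl⟩ := e.surjective w
    have h : a • (j - i) ∈ connectionSet X e ↔ j - i ∈ connectionSet X e := by
      conv_lhs => rw [← MulAction.mem_stabilizer_iff.mp ha]
      exact Set.smul_mem_smul_set_iff
    rw [he.adj_iff, ← h]
    simp [he.adj_iff, Units.smul_def, mul_sub]

theorem IsCirculantLabelling.affineIso_apply (he : IsCirculantLabelling X e) {a : (ZMod p)ˣ}
    (ha : a ∈ multiplierGroup X e) (c i : ZMod p) : he.affineIso ha c (e i) = e (a * i + c) := by
  simp [affineIso]

/-- Two elements of `ℤ/p` are related when the corresponding vertices are in the same orbit of the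
stabilizer of `e 0`. -/
def orbitSetoid (X : SimpleGraph V) (e : ZMod p ≃ V) : Setoid (ZMod p) where
  r z w := ∃ σ : X ≃g X, σ (e 0) = e 0 ∧ σ (e z) = e w
  iseqv :=
    { refl := fun _ => ⟨RelIso.refl _, rfl, rfl⟩
      symm := fun ⟨σ, h₀, h⟩ => ⟨σ.symm, by simp [RelIso.symm_apply_eq, h₀],
        by simp [RelIso.symm_apply_eq, h]⟩
      trans := fun ⟨σ, h₀, h⟩ ⟨τ, h₀', h'⟩ => ⟨σ.trans τ, by simp [h₀, h₀'], by simp [h, h']⟩ }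

variable [Fact p.Prime]

theorem IsCirculantLabelling.isSchurPartition (he : IsCirculantLabelling X e) :
    IsSchurPartition (orbitSetoid X e) where
  eq_zero_iff := by
    rintro a b ⟨σ, h₀, h⟩
    constructor
    · rintro rfl
      exact e.injective (h.symm.trans h₀)
    · rintro rfl
      exact e.injective (σ.injective (h.trans h₀.symm))
  convolution := by
    rintro f g hf hg a b ⟨σ, h₀, h⟩
    let π : ZMod p ≃ ZMod p := (e.trans σ.toEquiv).trans e.symm
    have hπ : ∀ x, e (π x) = σ (e x) := fun x => by simp [π]
    refine Fintype.sum_equiv π _ _ fun x => ?_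
    congr 1
    · exact hf _ _ ⟨σ, h₀, (hπ x).symm⟩
    -- Conjugating `σ` by translations sends `0 → x → π x → 0` and `a - x → a → b → b - π x`.
    · refine hg _ _ ⟨((he.affineIso (one_mem _) x).trans σ).trans
        (he.affineIso (one_mem _) (-π x)), ?_, ?_⟩
      · simp [he.affineIso_apply, ← hπ]
      · simp [he.affineIso_apply, h, sub_eq_add_neg]

/-- The orbits of the stabilizer of a vertex are the cosets of the multiplier group. -/
theorem IsCirculantLabelling.stabilizer_orbit_eq (he : IsCirculantLabelling X e) (x : ZMod p) :
    {z | ∃ σ : X ≃g X, σ (e 0) = e 0 ∧ σ (e x) = z} = e '' affineCoset X e x 0 := by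
  ext v
  obtain ⟨z, rfl⟩ := e.surjective v
  rw [e.injective.mem_set_image]
  constructor
  · intro hz
    have hS : ClassInvariant (orbitSetoid X e) (· ∈ connectionSet X e) := by
      rintro a b ⟨σ, h₀, h⟩
      refine propext ?_
      change X.Adj (e 0) (e a) ↔ X.Adj (e 0) (e b)
      rw [← h, ← σ.map_adj_iff, h₀]
    obtain ⟨c, hc, hzc⟩ := he.isSchurPartition.exists_mem_stabilizer hS hz
    exact ⟨c, hc, by rw [hzc]; ring⟩
  · rintro ⟨a, ha, rfl⟩
    exact ⟨he.affineIso ha 0, by simp [he.affineIso_apply],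
      by simp [he.affineIso_apply, mul_comm]⟩

theorem IsCirculantLabelling.isNontrivialOrbit_iff (he : IsCirculantLabelling X e) (O : Set V) :
    IsNontrivialOrbit X (e 0) O ↔ ∃ x : ZMod p, x ≠ 0 ∧ O = e '' affineCoset X e x 0 := by
  constructor
  · rintro ⟨w, hw, rfl⟩
    obtain ⟨x, rfl⟩ := e.surjective w
    exact ⟨x, fun h => hw (h ▸ rfl), he.stabilizer_orbit_eq x⟩
  · rintro ⟨x, hx, rfl⟩
    exact ⟨e x, fun h => hx (e.injective h), (he.stabilizer_orbit_eq x).symm⟩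

theorem IsCirculantLabelling.orbitAt_one (he : IsCirculantLabelling X e) {x : ZMod p}
    (hx : x ≠ 0) :
    orbitAt X (e 0) (e '' affineCoset X e x 0) (e 1) = e '' affineCoset X e x 1 := by
  have h := orbitAt_eq_image X ((he.isNontrivialOrbit_iff _).mpr ⟨x, hx, rfl⟩)
    (he.affineIso (one_mem _) 1)
  rw [he.affineIso_apply, Units.val_one, mul_zero, zero_add] at h
  rw [h, Set.image_image]
  simp only [he.affineIso_apply]
  rw [← Set.image_image e]
  congr 1
  ext z
  constructor
  · rintro ⟨_, ⟨a, ha, rfl⟩, rfl⟩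
    exact ⟨a, ha, by simp⟩
  · rintro ⟨a, ha, rfl⟩
    exact ⟨_, ⟨a, ha, rfl⟩, by simp⟩

theorem IsCirculantLabelling.hasSingletonIntersection_iff (he : IsCirculantLabelling X e) :
    HasSingletonIntersection X e ↔ ∃ x x' : ZMod p, x ≠ 0 ∧ x' ≠ 0 ∧
      (affineCoset X e x 0 ∩ affineCoset X e x' 1).ncard = 1 := by
  have key : ∀ x x' : ZMod p, x' ≠ 0 →
      (e '' affineCoset X e x 0 ∩ orbitAt X (e 0) (e '' affineCoset X e x' 0) (e 1)).ncard =
        (affineCoset X e x 0 ∩ affineCoset X e x' 1).ncard := by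
    intro x x' hx'
    rw [he.orbitAt_one hx', ← Set.image_inter e.injective,
      Set.ncard_image_of_injective _ e.injective]
  constructor
  · rintro ⟨O₁, O₂, h₁, h₂, hO⟩
    obtain ⟨x, hx, rfl⟩ := (he.isNontrivialOrbit_iff _).mp h₁
    obtain ⟨x', hx', rfl⟩ := (he.isNontrivialOrbit_iff _).mp h₂
    exact ⟨x, x', hx, hx', key x x' hx' ▸ hO⟩
  · rintro ⟨x, x', hx, hx', h⟩
    exact ⟨_, _, (he.isNontrivialOrbit_iff _).mpr ⟨x, hx, rfl⟩,
      (he.isNontrivialOrbit_iff _).mpr ⟨x', hx', rfl⟩, (key x x' hx').trans h⟩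

end ClassicalOrbits

/-! ### Absence of quantum symmetry -/

section NoQuantumSymmetry

/-- Centralizers are closed, so passing from generators to the whole algebra twice, once in each
factor, suffices. Self-adjoint generators make the starred half of the centralizer condition
automatic. -/
theorem noQuantumSymmetry_of_commute {V : Type*} [Fintype V] (X : SimpleGraph V)
    (h : ∀ i j k l, Commute (QAut.u X i j) (QAut.u X k l)) : NoQuantumSymmetry X := by
  set G : Set (RepProduct X) := Set.range fun ij : V × V => repGenerator X ij.1 ij.2
  have hstar : ∀ g ∈ G, star g = g := by
    rintro _ ⟨⟨i, j⟩, rfl⟩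
    exact congrArg Subtype.val
      ((QAut.satisfiesRelations X).magic.isStarProjection i j).isSelfAdjoint.star_eq
  have hle : ∀ s : Set (RepProduct X), (∀ g ∈ G, ∀ a ∈ s, a * g = g * a) →
      QAut X ≤ StarSubalgebra.centralizer ℂ s := by
    intro s hs
    refine StarSubalgebra.topologicalClosure_minimal (StarAlgebra.adjoin_le fun g hg => ?_) ?_
    · rw [SetLike.mem_coe, StarSubalgebra.mem_centralizer_iff]
      refine fun a ha => ⟨hs g hg a ha, ?_⟩
      have := congrArg star (hs g hg a ha)
      rw [star_mul, star_mul, hstar g hg] at this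
      exact this.symm
    · rw [StarSubalgebra.coe_centralizer]
      exact Set.isClosed_centralizer _
  have h₁ : QAut X ≤ StarSubalgebra.centralizer ℂ G := hle G <| by
    rintro _ ⟨⟨i, j⟩, rfl⟩ _ ⟨⟨k, l⟩, rfl⟩
    exact congrArg Subtype.val (h k l i j)
  have h₂ : QAut X ≤ StarSubalgebra.centralizer ℂ (QAut X : Set (RepProduct X)) :=
    hle _ fun g hg a ha => (((StarSubalgebra.mem_centralizer_iff ℂ).mp (h₁ ha)) g hg).1.symm
  exact fun a b => Subtype.ext (((StarSubalgebra.mem_centralizer_iff ℂ).mp (h₂ b.2)) a a.2).1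

theorem IsMagicUnitary.reindex {V W A : Type*} [Fintype V] [Fintype W] [Ring A] [StarRing A]
    {u : Matrix V V A} (hu : IsMagicUnitary u) (e : W ≃ V) : IsMagicUnitary (u.submatrix e e) where
  isStarProjection _ _ := hu.isStarProjection _ _
  row_orthogonal _ _ _ h := hu.row_orthogonal _ _ _ (e.injective.ne h)
  col_orthogonal _ _ _ h := hu.col_orthogonal _ _ _ (e.injective.ne h)
  row_sum i := (e.sum_comp fun j => u (e i) j).trans (hu.row_sum _)
  col_sum j := (e.sum_comp fun i => u i (e j)).trans (hu.col_sum _)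

/-- The common point `w` represents both cosets: `xE = wE` and `x'E = (w - 1)E`. -/
theorem exists_isIsolating {V : Type*} {X : SimpleGraph V} {p : ℕ} [Fact p.Prime]
    {e : ZMod p ≃ V} {x x' : ZMod p} (hx : x ≠ 0) (hx' : x' ≠ 0)
    (h : (affineCoset X e x 0 ∩ affineCoset X e x' 1).ncard = 1) :
    ∃ w : ZMod p, w ≠ 0 ∧ w ≠ 1 ∧ IsIsolating (multiplierGroup X e) w := by
  obtain ⟨w, hw⟩ := Set.ncard_eq_one.mp h
  obtain ⟨⟨a, ha, hwa⟩, ⟨b, hb, hwb⟩⟩ := hw.ge (Set.mem_singleton w)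
  refine ⟨w, ?_, ?_, ?_⟩
  · rw [hwa, add_zero]
    exact mul_ne_zero hx a.ne_zero
  · rw [hwb, Ne, add_eq_right]
    exact mul_ne_zero hx' b.ne_zero
  · rintro z ⟨c, hc, hzc⟩ ⟨d, hd, hzd⟩
    refine hw.le ⟨⟨a * c, Subgroup.mul_mem _ ha hc, ?_⟩, ⟨b * d, Subgroup.mul_mem _ hb hd, ?_⟩⟩
    · rw [Units.val_mul]
      linear_combination hzc + (c : ZMod p) * hwa
    · rw [Units.val_mul]
      linear_combination hzd + (d : ZMod p) * hwb

variable {V : Type*} [Fintype V] {X : SimpleGraph V} {p : ℕ} [Fact p.Prime] {e : ZMod p ≃ V}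

theorem SatisfiesRelations.respectsCosets {A : Type*} [Ring A] [StarRing A] [Module ℂ A]
    {u : Matrix V V A} (hu : SatisfiesRelations X u) (he : IsCirculantLabelling X e) :
    RespectsCosets (u.submatrix e e) (multiplierGroup X e) := by
  classical
  intro i j k l hne
  refine (hu.magic.reindex e).exists_mem_stabilizer ?_ hne
  have h := congrArg (fun M => M.submatrix e e) hu.comm
  simp only [← Matrix.submatrix_mul_equiv _ _ _ e] at h
  convert h using 2 <;> (ext a b; simp [SimpleGraph.adjMatrix_apply, he.adj_iff])

end NoQuantumSymmetry

end QuantumSym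

end

theorem mainTheorem1 {V : Type*} [Fintype V] (X : SimpleGraph V) (p : ℕ) (hp : p.Prime)
    (e : ZMod p ≃ V) (he : QuantumSym.IsCirculantLabelling X e) :
    (QuantumSym.HasSingletonIntersection X e ↔
      ∃ x x' : ZMod p, x ≠ 0 ∧ x' ≠ 0 ∧
        (QuantumSym.affineCoset X e x 0 ∩ QuantumSym.affineCoset X e x' 1).ncard = 1) ∧
    (QuantumSym.HasSingletonIntersection X e → QuantumSym.NoQuantumSymmetry X) := by
  have := Fact.mk hp
  refine ⟨he.hasSingletonIntersection_iff, fun h => ?_⟩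
  obtain ⟨x, x', hx, hx', hcard⟩ := he.hasSingletonIntersection_iff.mp h
  obtain ⟨w, hw₀, hw₁, hw⟩ := QuantumSym.exists_isIsolating hx hx' hcard
  refine QuantumSym.noQuantumSymmetry_of_commute X fun i j k l => ?_
  have hrel := QuantumSym.QAut.satisfiesRelations X
  have hcomm := (hrel.magic.reindex e).commute (hrel.respectsCosets he) hw hw₀ hw₁
    (e.symm i) (e.symm j) (e.symm k) (e.symm l)
  simpa using hcomm
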